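/- **Theorem (Further convergence acceleration for SPRE).** Let $A\subset\mathbb N_0^d$ be a finite set of multi-indices with $\mathbf 0\in A$, and let $\mathcal P_A$ be the span of the monomials $\mathbf x^{\boldsymbol\alpha}$, $\boldsymbol\alpha\in A$. Let $\mathbf 0\in\mathcal X\subset\mathbb R^d$ and let $X_n=\{\mathbf x_i\}_{i=1}^n\subset\mathcal X$ be distinct points that are $\mathcal P_A$-unisolvent, i.e. the Vandermonde matrix $[\mathbf x_i^{\boldsymbol\alpha}]_{i\le n,\,\boldsymbol\alpha\in A}$ has full column rank. Call $h\in(0,1]$ a *permissible scaling* if $h\mathbf x\in\mathcal X$ for all $\mathbf x\in\mathcal X$, and put $\mathcal X_h=\{h\mathbf x:\mathbf x\in\mathcal X\}$ and $X_n^h=\{h\mathbf x_i\}_{i=1}^n$. Let $s\ge 0$ be such that $2s$ is an integer and every multi-index $\boldsymbol\alpha\in\mathbb N_0^d$ with $|\boldsymbol\alpha|<2s$ belongs to $A$ (in particular, $s$ may be taken maximal with this property). Let $k:\mathcal X\times\mathcal X\to\mathbb R$ be a symmetric, (strictly) positive definite kernel of the form $k(\mathbf x,\mathbf y)=\phi(\mathbf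 x-\mathbf y)$, where $\phi:\mathbb R^d\to\mathbb R$ is $2s$ times continuously differentiable at $\mathbf 0$. For a set $\mathcal Y\subseteq\mathcal X$ let $\mathcal H_k(\mathcal Y)$ be the reproducing kernel Hilbert space of real functions on $\mathcal Y$ with kernel $k|_{\mathcal Y\times\mathcal Y}$. For a function $f$ and distinct unisolvent points $Z=\{\mathbf z_i\}_{i=1}^n\subset\mathcal X$, let $\mathbf K=[k(\mathbf z_i,\mathbf z_j)]$, $\mathbf V=[\mathbf z_i^{\boldsymbol\alpha}]_{i\le n,\,\boldsymbol\alpha\in A}$, $\mathbf f=[f(\mathbf z_i)]$, $\mathbf k(\mathbf x)=[k(\mathbf z_i,\mathbf x)]$, $\mathbf v(\mathbf x)=[\mathbf x^{\boldsymbol\alpha}]_{\boldsymbol\alpha\in A}$, and let $$\mathbb E[f(\mathbf x)\mid Z]=\mathbf k(\mathbf x)^\top\mathbf K^{-1}\mathbf f+\big(\mathbf v(\mathbf x)-\mathbf V^\top\mathbf K^{-1}\mathbf k(\mathbf x)\big)^\top(\mathbf V^\top\mathbf K^{-1}\mathbf V)^{-1}\mathbf V^\top\mathbf K^{-1}\mathbf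 f$$ be the SPRE posterior mean given the data $f|_Z$. Then there are constants $C_{h,k}\in\mathbb R$, one for each permissible scaling $h$ and not depending on $f$, such that for every permissible $h$, every $f:\mathcal X\to\mathbb R$ and all coefficients $\beta_{\boldsymbol\alpha}$ ($\boldsymbol\alpha\in A$) for which the residual $R(\mathbf x)=f(\mathbf x)-\sum_{\boldsymbol\alpha\in A}\beta_{\boldsymbol\alpha}\mathbf x^{\boldsymbol\alpha}$ belongs to $\mathcal H_k(\mathcal X)$, the restriction of $R$ to $\mathcal X_h$ belongs to $\mathcal H_k(\mathcal X_h)$ and $$\big|f(\mathbf 0)-\mathbb E[f(\mathbf 0)\mid X_n^h]\big|\le C_{h,k}\,\|R\|_{\mathcal H_k(\mathcal X_h)},$$ with $\sup_h C_{h,k}<\infty$ and $C_{h,k}=O(h^s)$ as $h\to0$ along permissible scalings. -/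

import Mathlib

open scoped Matrix Topology

namespace SPRE

/-- Points of `ℝ^d`. -/
abbrev Pt (d : ℕ) : Type := EuclideanSpace ℝ (Fin d)

/-- The total degree `|α| = α₁ + ⋯ + α_d` of a multi-index. -/
def degree {d : ℕ} (α : Fin d → ℕ) : ℕ := ∑ i, α i

/-- The monomial `x^α = x₁^α₁ ⋯ x_d^α_d`. -/
noncomputable def monomial {d : ℕ} (α : Fin d → ℕ) (x : Pt d) : ℝ := ∏ i, x i ^ α i

/-- The Vandermonde matrix `V_A(X_n)`, with rows indexed by the points and columns by `A`. -/
noncomputable def vandermonde {d n : ℕ} (A : Finset (Fin d → ℕ)) (x : Fin n → Pt d) :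
    Matrix (Fin n) A ℝ :=
  Matrix.of fun i α => monomial α.1 (x i)

/-- `P_A`-unisolvency: the Vandermonde matrix has full (column) rank, i.e. the zero polynomial is
the only element of `P_A` vanishing at all the points. -/
def Unisolvent {d n : ℕ} (A : Finset (Fin d → ℕ)) (x : Fin n → Pt d) : Prop :=
  (vandermonde A x).rank = A.card

/-- The kernel (Gram) matrix `K = [k(x_i, x_j)]`. -/
def gram {d n : ℕ} (k : Pt d → Pt d → ℝ) (x : Fin n → Pt d) : Matrix (Fin n) (Fin n) ℝ :=
  Matrix.of fun i j => k (x i) (x j)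

/-- The generalised least squares coefficients `(Vᵀ K⁻¹ V)⁻¹ Vᵀ K⁻¹ f`. -/
noncomputable def betaHat {d n : ℕ} (k : Pt d → Pt d → ℝ) (A : Finset (Fin d → ℕ))
    (x : Fin n → Pt d) (f : Pt d → ℝ) : A → ℝ :=
  ((vandermonde A x)ᵀ * (gram k x)⁻¹ * vandermonde A x)⁻¹ *ᵥ
    ((vandermonde A x)ᵀ *ᵥ ((gram k x)⁻¹ *ᵥ fun i => f (x i)))

/-- The vector `r_A(z) = v_A(z) - Vᵀ K⁻¹ k(z)`. -/
noncomputable def rVec {d n : ℕ} (k : Pt d → Pt d → ℝ) (A : Finset (Fin d → ℕ))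
    (x : Fin n → Pt d) (z : Pt d) : A → ℝ :=
  (fun α : A => monomial α.1 z) -
    (vandermonde A x)ᵀ *ᵥ ((gram k x)⁻¹ *ᵥ fun i => k (x i) z)

/-- The SPRE posterior mean at `z` given the data `f (x i)`, that is
`k(z)ᵀ K⁻¹ f + r_A(z)ᵀ β̂_A`. -/
noncomputable def posteriorMean {d n : ℕ} (k : Pt d → Pt d → ℝ) (A : Finset (Fin d → ℕ))
    (x : Fin n → Pt d) (f : Pt d → ℝ) (z : Pt d) : ℝ :=
  (fun i => k (x i) z) ⬝ᵥ ((gram k x)⁻¹ *ᵥ fun i => f (x i)) + rVec k A x z ⬝ᵥ betaHat k A x f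

/-- `k` is a symmetric (strictly) positive definite kernel on the set `Y`: it is symmetric on `Y`
and `∑ c_i c_j k(y_i, y_j) > 0` for distinct `y_i ∈ Y` and `c ≠ 0`. -/
def IsPosDefKernel {d : ℕ} (Y : Set (Pt d)) (k : Pt d → Pt d → ℝ) : Prop :=
  (Matrix.of fun a b : Y => k a b).PosDef

/-- `g`, restricted to `Y`, belongs to the reproducing kernel Hilbert space `H_k(Y)` of real
functions on `Y` with reproducing kernel `k`, and `‖g‖_{H_k(Y)} = c`. -/
def HasRKHSNorm {d : ℕ} (Y : Set (Pt d)) (k : Pt d → Pt d → ℝ) (g : Pt d → ℝ) (c : ℝ) : Prop :=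
  ∃ (H : Type) (_ : NormedAddCommGroup H) (_ : InnerProductSpace ℝ H) (_ : CompleteSpace H)
    (_ : RKHS ℝ H Y ℝ),
    (∀ (y z : Y) (t : ℝ), RKHS.kernel H y z t = k y z * t) ∧
    ∃ u : H, (∀ y : Y, u y = g y) ∧ ‖u‖ = c

/-- The residual `R(x) = f(x) - ∑_{α ∈ A} β_α x^α`. -/
noncomputable def residual {d : ℕ} (A : Finset (Fin d → ℕ)) (f : Pt d → ℝ)
    (β : (Fin d → ℕ) → ℝ) (x : Pt d) : ℝ :=
  f x - ∑ α ∈ A, β α * monomial α x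

/-- The permissible scalings `h ∈ (0, 1]` of `X`: those with `h x ∈ X` whenever `x ∈ X`. -/
def permissible {d : ℕ} (X : Set (Pt d)) : Set ℝ :=
  {h | 0 < h ∧ h ≤ 1 ∧ ∀ x ∈ X, h • x ∈ X}

/-- The scaled domain `X_h = {h x : x ∈ X}`. -/
def scaled {d : ℕ} (X : Set (Pt d)) (h : ℝ) : Set (Pt d) := (fun x => h • x) '' X

end SPRE

/-! The posterior mean is a linear rule reproducing `P_A`, so its error at `0` depends only on `R`
and is at most `‖R‖` times the RKHS norm of the error functional. Among all rules reproducing `P_A`,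
its weights minimise that norm (`exists_weights`, `norm_sub_sum_le`), so any fixed competitor bounds
it. Since scaling fixes the origin, weights `u` that reproduce `P_A` at `0` from `X_n` still do so
from every `X_n^h`; this gives one competitor independent of `h`.

The squared norm for `u` is a quadratic form in `φ(h(y_a - y_b))`, over the nodes and the origin,
whose coefficients have vanishing moments of order below `m = 2s`. These annihilate the Taylor
polynomial of `φ`, leaving `O(h ^ m)` (`quadForm_isBigO`); the square root gives `h ^ s`. -/

/-- Taylor's theorem at the origin, with a big-O remainder. -/
theorem ContDiffAt.sub_taylor_isBigO {E : Type*} [NormedAddCommGroup E] [NormedSpace ℝ E]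
    {φ : E → ℝ} {m : ℕ} (hφ : ContDiffAt ℝ m φ 0) :
    (fun y => φ y - ∑ k ∈ Finset.range m,
      (k.factorial : ℝ)⁻¹ • iteratedFDeriv ℝ k φ 0 (fun _ => y)) =O[𝓝 0] fun y => ‖y‖ ^ m := by
  rcases m with _ | N
  -- For order `0` the Taylor sum is empty, and continuity gives local boundedness.
  · simpa using hφ.continuousAt.isBigO_one ℝ
  have hc : ContinuousAt (iteratedFDeriv ℝ (N + 1) φ) 0 :=
    hφ.continuousAt_iteratedFDeriv (by norm_cast)
  have hb : ∀ᶠ y in 𝓝 (0 : E), ‖iteratedFDeriv ℝ (N + 1) φ y‖ <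
      ‖iteratedFDeriv ℝ (N + 1) φ 0‖ + 1 :=
    hc.norm.eventually_lt continuousAt_const (lt_add_one _)
  have hd : ∀ᶠ y in 𝓝 (0 : E), ContDiffAt ℝ (N + 1 : ℕ) φ y :=
    hφ.eventually (by simp)
  obtain ⟨ε, hε, hball⟩ := Metric.eventually_nhds_iff_ball.1 (hb.and hd)
  set M := ‖iteratedFDeriv ℝ (N + 1) φ 0‖ + 1
  refine Asymptotics.IsBigO.of_bound ((N.factorial : ℝ)⁻¹ * M) ?_
  filter_upwards [Metric.ball_mem_nhds (0 : E) hε] with y hy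
  have hseg : ∀ t ∈ Set.Icc (0 : ℝ) 1, t • y ∈ Metric.ball (0 : E) ε := by
    intro t ht
    rw [mem_ball_zero_iff] at hy ⊢
    rw [norm_smul, Real.norm_of_nonneg ht.1]
    exact (mul_le_of_le_one_left (norm_nonneg _) ht.2).trans_lt hy
  have hT := map_add_eq_sum_add_integral_iteratedFDeriv (f := φ) (x := 0) (y := y) (n := N)
    (fun t ht => by simpa using (hball _ (hseg t ht)).2)
  rw [zero_add] at hT
  rw [hT, add_sub_cancel_left, norm_smul, mul_assoc]
  have hI : ‖∫ t in (0 : ℝ)..1, (1 - t) ^ N • iteratedFDeriv ℝ (N + 1) φ (0 + t • y) (fun _ => y)‖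
      ≤ (M * ‖y‖ ^ (N + 1)) * |1 - 0| := by
    refine intervalIntegral.norm_integral_le_of_norm_le_const fun t ht => ?_
    rw [Set.uIoc_of_le zero_le_one] at ht
    have ht' : t ∈ Set.Icc (0 : ℝ) 1 := ⟨ht.1.le, ht.2⟩
    have h1 : ‖iteratedFDeriv ℝ (N + 1) φ (t • y) (fun _ => y)‖ ≤ M * ‖y‖ ^ (N + 1) := by
      refine (ContinuousMultilinearMap.le_opNorm _ _).trans ?_
      simp only [Finset.prod_const, Finset.card_univ, Fintype.card_fin]
      gcongr
      exact (hball _ (hseg t ht')).1.le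
    have h2 : ‖(1 - t) ^ N‖ ≤ 1 := by
      rw [norm_pow, Real.norm_of_nonneg (by linarith [ht.2])]
      exact pow_le_one₀ (by linarith [ht.2]) (by linarith [ht.1])
    rw [norm_smul, zero_add]
    exact (mul_le_of_le_one_left (norm_nonneg _) h2).trans h1
  have h3 : ‖((N.factorial : ℝ)⁻¹)‖ = (N.factorial : ℝ)⁻¹ := by
    rw [Real.norm_of_nonneg]; positivity
  rw [h3, norm_pow, norm_norm]
  gcongr
  simpa using hI

namespace SPRE

variable {d n : ℕ}

/-! ### Vanishing moments and decay of the quadratic form -/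

/-- A product of coordinates is a monomial. -/
theorem prod_coord_eq_monomial {ι : Type*} (S : Finset ι) (r : ι → Fin d) (y : Pt d) :
    ∏ l ∈ S, y (r l) = monomial (fun i => (S.filter fun l => r l = i).card) y := by
  rw [monomial, ← Finset.prod_fiberwise S r]
  refine Finset.prod_congr rfl fun i _ => ?_
  rw [Finset.prod_congr rfl fun l hl => by rw [(Finset.mem_filter.1 hl).2], Finset.prod_const]

theorem degree_card_fibers {ι : Type*} (S : Finset ι) (r : ι → Fin d) :
    degree (fun i => (S.filter fun l => r l = i).card) = S.card :=
  (Finset.card_eq_sum_card_fiberwise fun _ _ => Finset.mem_coe.2 (Finset.mem_univ _)).symm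

/-- If `∑ c_a δ_{y_a}` has vanishing moments of order less than `m`, its pairing with any
homogeneous polynomial of degree `j < m` in the difference variable vanishes. -/
theorem sum_sum_multilinear_sub_eq_zero {ι : Type*} [Fintype ι] {c : ι → ℝ} {y : ι → Pt d}
    {m j : ℕ} (hc : ∀ α, degree α < m → ∑ a, c a * monomial α (y a) = 0) (hj : j < m)
    (M : MultilinearMap ℝ (fun _ : Fin j => Pt d) ℝ) :
    ∑ a, ∑ b, c a * c b * M (fun _ => y a - y b) = 0 := by
  have hM : ∀ v : Pt d, M (fun _ => v) = ∑ r : Fin j → Fin d,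
      (∏ l, v (r l)) * M (fun l => EuclideanSpace.single (r l) (1 : ℝ)) := by
    intro v
    have hv : v = ∑ i, v i • EuclideanSpace.single i (1 : ℝ) := by
      ext i
      simp [Pi.single_apply]
    calc M (fun _ => v)
        = M (fun _ : Fin j => ∑ i, v i • EuclideanSpace.single i (1 : ℝ)) := by rw [← hv]
      _ = _ := by
        rw [MultilinearMap.map_sum]
        refine Finset.sum_congr rfl fun r _ => ?_
        rw [MultilinearMap.map_smul_univ, smul_eq_mul]
  -- After expansion, each term separates into a factor in `y a` and one in `y b`. The former has
  -- degree `|S| ≤ j < m`, so the sum over `a` alone already vanishes.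
  have hprod : ∀ (r : Fin j → Fin d) (a b : ι), ∏ l, (y a - y b) (r l) =
      ∑ S ∈ (Finset.univ : Finset (Fin j)).powerset,
        (∏ l ∈ S, y a (r l)) * ∏ l ∈ Finset.univ \ S, -y b (r l) := by
    intro r a b
    rw [← Finset.prod_add]
    simp [sub_eq_add_neg]
  have hz : ∀ (r : Fin j → Fin d) (S : Finset (Fin j)), ∑ a, c a * ∏ l ∈ S, y a (r l) = 0 := by
    intro r S
    simp_rw [prod_coord_eq_monomial S r]
    refine hc _ ?_
    rw [degree_card_fibers]
    exact (S.card_le_univ.trans_eq (Fintype.card_fin j)).trans_lt hj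
  simp_rw [hM, hprod, Finset.sum_mul, Finset.mul_sum]
  rw [Finset.sum_comm]
  refine Finset.sum_eq_zero fun b _ => ?_
  rw [Finset.sum_comm]
  refine Finset.sum_eq_zero fun r _ => ?_
  rw [Finset.sum_comm]
  refine Finset.sum_eq_zero fun S _ => ?_
  calc _ = (∑ a, c a * ∏ l ∈ S, y a (r l)) * (c b * (∏ l ∈ Finset.univ \ S, -y b (r l)) *
        M (fun l => EuclideanSpace.single (r l) (1 : ℝ))) := by
        rw [Finset.sum_mul]
        exact Finset.sum_congr rfl fun a _ => by ring
    _ = 0 := by rw [hz, zero_mul]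

theorem monomial_smul (h : ℝ) (α : Fin d → ℕ) (y : Pt d) :
    monomial α (h • y) = h ^ degree α * monomial α y := by
  simp [monomial, degree, mul_pow, Finset.prod_mul_distrib, Finset.prod_pow_eq_pow_sum]

/-- The quadratic form of a translation-invariant kernel along shrinking nodes decays like `h ^ m`
when the moments of order less than `m` vanish. -/
theorem quadForm_isBigO {ι : Type*} [Fintype ι] {φ : Pt d → ℝ} {c : ι → ℝ} {y : ι → Pt d} {m : ℕ}
    (hφ : ContDiffAt ℝ m φ 0) (hc : ∀ α, degree α < m → ∑ a, c a * monomial α (y a) = 0) :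
    (fun h : ℝ => ∑ a, ∑ b, c a * c b * φ (h • y a - h • y b)) =O[𝓝 0] fun h => h ^ m := by
  set T : Pt d → ℝ := fun z => ∑ k ∈ Finset.range m,
    (k.factorial : ℝ)⁻¹ • iteratedFDeriv ℝ k φ 0 (fun _ => z) with hTdef
  have hT : ∀ h : ℝ, ∑ a, ∑ b, c a * c b * T (h • y a - h • y b) = 0 := by
    intro h
    have hc' : ∀ α, degree α < m → ∑ a, c a * monomial α (h • y a) = 0 := by
      intro α hα
      rw [← mul_zero (h ^ degree α), ← hc α hα, Finset.mul_sum]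
      exact Finset.sum_congr rfl fun a _ => by rw [monomial_smul]; ring
    simp_rw [hTdef, Finset.mul_sum]
    rw [Finset.sum_congr rfl fun a _ => Finset.sum_comm, Finset.sum_comm]
    refine Finset.sum_eq_zero fun k hk => ?_
    have := sum_sum_multilinear_sub_eq_zero hc' (Finset.mem_range.1 hk)
      (iteratedFDeriv ℝ k φ 0).toMultilinearMap
    simp_rw [smul_eq_mul, mul_left_comm _ ((k.factorial : ℝ)⁻¹), ← Finset.mul_sum]
    rw [mul_eq_zero]
    exact Or.inr this
  have heq : (fun h : ℝ => ∑ a, ∑ b, c a * c b * φ (h • y a - h • y b)) = fun h =>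
      ∑ a, ∑ b, c a * c b * (φ (h • y a - h • y b) - T (h • y a - h • y b)) := by
    ext h
    simp_rw [mul_sub, Finset.sum_sub_distrib, hT h, sub_zero]
  rw [heq]
  refine Asymptotics.IsBigO.fun_sum fun a _ => Asymptotics.IsBigO.fun_sum fun b _ => ?_
  refine Asymptotics.IsBigO.const_mul_left ?_ _
  have hlim : Filter.Tendsto (fun h : ℝ => h • y a - h • y b) (𝓝 0) (𝓝 0) := by
    have : Continuous fun h : ℝ => h • y a - h • y b := by fun_prop
    simpa using this.tendsto 0
  refine ((hφ.sub_taylor_isBigO).comp_tendsto hlim).trans ?_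
  refine Asymptotics.IsBigO.of_bound (‖y a - y b‖ ^ m) (Filter.Eventually.of_forall fun h => ?_)
  simp only [Function.comp_apply, ← smul_sub, norm_smul, norm_pow, norm_mul, norm_norm, mul_pow]
  rw [mul_comm]

/-! ### Restriction of reproducing kernel Hilbert spaces -/

/-- Elements of a reproducing kernel Hilbert space on `X` restrict to elements of the one
on a subset. -/
theorem HasRKHSNorm.restrict {X Y : Set (Pt d)} {k : Pt d → Pt d → ℝ} {g : Pt d → ℝ} {c : ℝ}
    (hg : HasRKHSNorm X k g c) (hYX : Y ⊆ X) : ∃ r, HasRKHSNorm Y k g r := by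
  obtain ⟨H, _, _, _, _, hker, u, hu, -⟩ := hg
  let ρ : H →L[ℝ] (Y → ℝ) := ContinuousLinearMap.pi fun y =>
    (ContinuousLinearMap.proj (⟨y, hYX y.2⟩ : X)).comp (RKHS.coeCLM (X := X) (V := ℝ) ℝ)
  have hρ : ∀ (v : H) (y : Y), ρ v y = v (⟨y, hYX y.2⟩ : X) := fun _ _ => rfl
  -- The space on `Y` is realised as the orthogonal complement of the functions vanishing on `Y`;
  -- restriction is injective there, and it contains the kernel sections at points of `Y`.
  let N : Submodule ℝ H := LinearMap.ker ρ.toLinearMap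
  have hNc : IsClosed (N : Set H) := ρ.isClosed_ker
  have : CompleteSpace N := hNc.completeSpace_coe
  let inst : RKHS ℝ Nᗮ Y ℝ :=
    { coeCLM := ρ.comp Nᗮ.subtypeL
      coeCLM_injective := by
        refine (injective_iff_map_eq_zero _).mpr fun v hv => ?_
        have h1 : (v : H) ∈ N := hv
        exact Subtype.ext (inner_self_eq_zero.1 (Submodule.inner_right_of_mem_orthogonal h1 v.2)) }
  have hinst : ∀ (v : Nᗮ) (y : Y), v y = (v : H) (⟨y, hYX y.2⟩ : X) := fun _ _ => rfl
  refine ⟨‖Nᗮ.orthogonalProjectionOnto u‖, Nᗮ, inferInstance, inferInstance, inferInstance, inst,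
    fun y z t => ?_, Nᗮ.orthogonalProjectionOnto u, fun y => ?_, rfl⟩
  · have hmem : RKHS.kerFun H (⟨z, hYX z.2⟩ : X) t ∈ Nᗮ := by
      refine (Submodule.mem_orthogonal _ _).2 fun v hv => ?_
      have hvz : v (⟨z, hYX z.2⟩ : X) = 0 := congrFun (show ρ v = 0 from hv) z
      rw [RKHS.inner_kerFun, hvz, inner_zero_left]
    have hker' : RKHS.kerFun Nᗮ z t = ⟨_, hmem⟩ := by
      refine ext_inner_right ℝ fun w => ?_
      rw [RKHS.kerFun_inner, hinst, Submodule.coe_inner, RKHS.kerFun_inner]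
    rw [← RKHS.kerFun_apply, hker', hinst, RKHS.kerFun_apply, hker]
  · have hmem : u - Nᗮ.orthogonalProjectionOnto u ∈ N := by
      have := Submodule.sub_starProjection_mem_orthogonal (K := Nᗮ) u
      rwa [Submodule.orthogonal_orthogonal] at this
    have h0 : (u - Nᗮ.orthogonalProjectionOnto u : H) (⟨y, hYX y.2⟩ : X) = 0 :=
      congrFun (show ρ _ = 0 from hmem) y
    rw [RKHS.coe_sub, Pi.sub_apply, sub_eq_zero] at h0
    rw [hinst, ← h0, hu]

/-! ### Positive definiteness and unisolvency -/

theorem IsPosDefKernel.gram_posDef {X : Set (Pt d)} {k : Pt d → Pt d → ℝ}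
    (hk : IsPosDefKernel X k) {z : Fin n → Pt d} (hz : Function.Injective z)
    (hzX : ∀ i, z i ∈ X) : (gram k z).PosDef :=
  Matrix.PosDef.submatrix hk (e := fun i => (⟨z i, hzX i⟩ : X))
    fun _ _ hij => hz (congrArg Subtype.val hij)

theorem IsPosDefKernel.symm {X : Set (Pt d)} {k : Pt d → Pt d → ℝ} (hk : IsPosDefKernel X k)
    {y z : Pt d} (hy : y ∈ X) (hz : z ∈ X) : k y z = k z y := by
  simpa using (Matrix.PosDef.isHermitian hk).apply (⟨y, hy⟩ : X) ⟨z, hz⟩ |>.symm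

theorem IsPosDefKernel.abs_le {X : Set (Pt d)} {k : Pt d → Pt d → ℝ} (hk : IsPosDefKernel X k)
    {y z : Pt d} (hy : y ∈ X) (hz : z ∈ X) : |k y z| ≤ (k y y + k z z) / 2 := by
  have hP := (Matrix.PosDef.posSemidef hk).submatrix (![⟨y, hy⟩, ⟨z, hz⟩] : Fin 2 → X)
  have h1 := hP.dotProduct_mulVec_nonneg ![1, 1]
  have h2 := hP.dotProduct_mulVec_nonneg ![1, -1]
  simp [Matrix.mulVec, dotProduct, Fin.sum_univ_two] at h1 h2
  have h3 := hk.symm hy hz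
  rw [_root_.abs_le]
  constructor <;> linarith

theorem Unisolvent.mulVec_injective {A : Finset (Fin d → ℕ)} {x : Fin n → Pt d}
    (hU : Unisolvent A x) : Function.Injective (vandermonde A x).mulVec := by
  rw [Matrix.mulVec_injective_iff, linearIndependent_iff_card_eq_finrank_span, Fintype.card_coe]
  rw [Unisolvent, Matrix.rank_eq_finrank_span_cols] at hU
  exact hU.symm

/-- Scaling the nodes only rescales column `α` by `h ^ |α|`, so unisolvency survives for `h ≠ 0`. -/
theorem vandermonde_smul_mulVec (A : Finset (Fin d → ℕ)) (x : Fin n → Pt d) (h : ℝ) (v : A → ℝ) :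
    vandermonde A (fun i => h • x i) *ᵥ v =
      vandermonde A x *ᵥ fun α => h ^ degree α.1 * v α := by
  ext i
  simp only [Matrix.mulVec, dotProduct, vandermonde, Matrix.of_apply, monomial_smul]
  exact Finset.sum_congr rfl fun α _ => by ring

theorem mulVec_vandermonde_smul_injective {A : Finset (Fin d → ℕ)} {x : Fin n → Pt d}
    (hV : Function.Injective (vandermonde A x).mulVec) {h : ℝ} (hh : h ≠ 0) :
    Function.Injective (vandermonde A (fun i => h • x i)).mulVec := by
  intro v v' hvv
  simp only [vandermonde_smul_mulVec] at hvv
  ext α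
  exact mul_left_cancel₀ (pow_ne_zero _ hh) (congrFun (hV hvv) α)

/-! ### Optimality of the posterior weights -/

/-- The SPRE posterior mean is a linear rule whose weights reproduce `P_A` and satisfy the
stationarity equations of constrained worst-case error minimisation. -/
theorem exists_weights {k : Pt d → Pt d → ℝ} (A : Finset (Fin d → ℕ)) {z : Fin n → Pt d}
    (hK : (gram k z).PosDef) (hV : Function.Injective (vandermonde A z).mulVec) (p : Pt d) :
    ∃ (w : Fin n → ℝ) (μ : A → ℝ),
      (vandermonde A z)ᵀ *ᵥ w = (fun α : A => monomial α.1 p) ∧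
      gram k z *ᵥ w = (fun i => k (z i) p) + vandermonde A z *ᵥ μ ∧
      ∀ f, posteriorMean k A z f p = ∑ i, w i * f (z i) := by
  set V := vandermonde A z with hVdef
  set K := gram k z with hKdef
  set b : Fin n → ℝ := fun i => k (z i) p with hb
  have hG : (Vᵀ * K⁻¹ * V).PosDef := by
    simpa using hK.inv.conjTranspose_mul_mul_same hV
  set G := Vᵀ * K⁻¹ * V with hGdef
  have hKu : IsUnit K.det := (Matrix.isUnit_iff_isUnit_det _).1 hK.isUnit
  have hGu : IsUnit G.det := (Matrix.isUnit_iff_isUnit_det _).1 hG.isUnit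
  have hKT : (K⁻¹)ᵀ = K⁻¹ := by simpa using hK.inv.isHermitian.eq
  have hGT : (G⁻¹)ᵀ = G⁻¹ := by simpa using hG.inv.isHermitian.eq
  have hKv : ∀ v, v ᵥ* K⁻¹ = K⁻¹ *ᵥ v := fun v => by rw [← Matrix.mulVec_transpose, hKT]
  have hGv : ∀ v, v ᵥ* G⁻¹ = G⁻¹ *ᵥ v := fun v => by rw [← Matrix.mulVec_transpose, hGT]
  set r := rVec k A z p with hr
  have hr' : r = (fun α : A => monomial α.1 p) - Vᵀ *ᵥ (K⁻¹ *ᵥ b) := rfl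
  refine ⟨K⁻¹ *ᵥ b + K⁻¹ *ᵥ (V *ᵥ (G⁻¹ *ᵥ r)), G⁻¹ *ᵥ r, ?_, ?_, fun f => ?_⟩
  · have h1 : Vᵀ *ᵥ (K⁻¹ *ᵥ (V *ᵥ (G⁻¹ *ᵥ r))) = r := by
      rw [Matrix.mulVec_mulVec, Matrix.mulVec_mulVec, Matrix.mulVec_mulVec, ← hGdef, Matrix.mul_nonsing_inv _ hGu, Matrix.one_mulVec]
    rw [Matrix.mulVec_add, h1, hr']
    abel
  · rw [Matrix.mulVec_add, Matrix.mulVec_mulVec, Matrix.mulVec_mulVec,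
      Matrix.mul_nonsing_inv _ hKu, Matrix.one_mulVec, Matrix.one_mulVec]
  · change b ⬝ᵥ (K⁻¹ *ᵥ fun i => f (z i)) +
      r ⬝ᵥ (G⁻¹ *ᵥ (Vᵀ *ᵥ (K⁻¹ *ᵥ fun i => f (z i)))) =
      (K⁻¹ *ᵥ b + K⁻¹ *ᵥ (V *ᵥ (G⁻¹ *ᵥ r))) ⬝ᵥ fun i => f (z i)
    rw [Matrix.dotProduct_mulVec, hKv, Matrix.dotProduct_mulVec r, hGv, Matrix.dotProduct_mulVec,
      Matrix.vecMul_transpose, Matrix.dotProduct_mulVec, hKv, add_dotProduct]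

/-- Stationarity implies optimality for constrained least-norm approximation. -/
theorem norm_sub_sum_le {H ι κ : Type*} [NormedAddCommGroup H] [InnerProductSpace ℝ H]
    [Fintype ι] [Fintype κ] {a₀ : H} {a : ι → H} {V : Matrix ι κ ℝ} {w u : ι → ℝ} {μ : κ → ℝ}
    (hwu : Vᵀ *ᵥ w = Vᵀ *ᵥ u)
    (hstat : ∀ i, inner ℝ (a i) (∑ j, w j • a j) = inner ℝ (a i) a₀ + (V *ᵥ μ) i) :
    ‖a₀ - ∑ i, w i • a i‖ ≤ ‖a₀ - ∑ i, u i • a i‖ := by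
  set e := a₀ - ∑ i, w i • a i with he
  set δ := ∑ i, (w - u) i • a i with hδ
  have hsum : a₀ - ∑ i, u i • a i = e + δ := by
    simp only [he, hδ, Pi.sub_apply, sub_smul, Finset.sum_sub_distrib]
    abel
  -- The residual `e` pairs with the `a i` as `-V μ`, while `w - u` lies in the kernel of `Vᵀ`.
  have hzero : inner ℝ e δ = 0 := by
    rw [real_inner_comm, hδ, sum_inner]
    have : ∀ i, inner ℝ ((w - u) i • a i) e = -((w - u) i * (V *ᵥ μ) i) := by
      intro i
      rw [real_inner_smul_left, he, inner_sub_right, hstat]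
      ring
    simp_rw [this, Finset.sum_neg_distrib]
    change -((w - u) ⬝ᵥ (V *ᵥ μ)) = 0
    rw [Matrix.dotProduct_mulVec, ← Matrix.mulVec_transpose, Matrix.mulVec_sub, hwu, sub_self,
      zero_dotProduct, neg_zero]
  have := norm_add_sq_real e δ
  rw [hsum]
  refine (sq_le_sq₀ (norm_nonneg _) (norm_nonneg _)).1 ?_
  nlinarith [sq_nonneg ‖δ‖]

/-! ### Worst-case error at the origin -/

/-- The nodes `0, x₁, …, xₙ`. -/
def augNodes (x : Fin n → Pt d) : Option (Fin n) → Pt d := fun a => a.elim 0 x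

/-- The coefficients of the error functional `f ↦ f(0) - ∑ i, u i * f (x i)`. -/
def errCoeff (u : Fin n → ℝ) : Option (Fin n) → ℝ := fun a => a.elim 1 fun i => -u i

/-- The squared worst-case error at the origin of the rule with weights `u` at scale `h`. -/
noncomputable def sqError (φ : Pt d → ℝ) (x : Fin n → Pt d) (u : Fin n → ℝ) (h : ℝ) : ℝ :=
  ∑ a, ∑ b, errCoeff u a * errCoeff u b * φ (h • augNodes x a - h • augNodes x b)

/-- Worst-case error bound for the SPRE posterior mean by that of any rule reproducing `P_A`. -/
theorem abs_sub_posteriorMean_le {Y : Set (Pt d)} {k : Pt d → Pt d → ℝ} {φ : Pt d → ℝ}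
    {A : Finset (Fin d → ℕ)} {x : Fin n → Pt d} {u : Fin n → ℝ} {h : ℝ}
    (hkφ : ∀ y ∈ Y, ∀ z ∈ Y, k y z = φ (y - z)) (h0 : (0 : Pt d) ∈ Y) (hxY : ∀ i, h • x i ∈ Y)
    (hK : (gram k fun i => h • x i).PosDef)
    (hV : Function.Injective (vandermonde A fun i => h • x i).mulVec)
    (hu : ∀ α ∈ A, ∑ i, u i * monomial α (h • x i) = monomial α 0)
    {f : Pt d → ℝ} {β : (Fin d → ℕ) → ℝ} {c : ℝ} (hc : HasRKHSNorm Y k (residual A f β) c) :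
    |f 0 - posteriorMean k A (fun i => h • x i) f 0| ≤ √(sqError φ x u h) * c := by
  obtain ⟨H, _, _, _, _, hker, g, hg, rfl⟩ := hc
  obtain ⟨w, μ, hw, hKw, hpost⟩ := exists_weights A hK hV 0
  have hw' : ∀ α ∈ A, ∑ i, w i * monomial α (h • x i) = monomial α 0 := fun α hα => by
    have := congrFun hw ⟨α, hα⟩
    simpa [Matrix.mulVec, dotProduct, vandermonde, mul_comm] using this
  have hinner : ∀ y z : Y, inner ℝ (RKHS.kerFun H y (1 : ℝ)) (RKHS.kerFun H z (1 : ℝ)) = k y z := by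
    intro y z
    rw [RKHS.kerFun_inner, RKHS.kerFun_apply, hker]
    simp
  set a₀ : H := RKHS.kerFun H (⟨0, h0⟩ : Y) (1 : ℝ) with ha₀
  set a : Fin n → H := fun i => RKHS.kerFun H (⟨h • x i, hxY i⟩ : Y) (1 : ℝ) with ha
  have hmin : ‖a₀ - ∑ i, w i • a i‖ ≤ ‖a₀ - ∑ i, u i • a i‖ := by
    refine norm_sub_sum_le (V := vandermonde A fun i => h • x i) (μ := μ) ?_ fun i => ?_
    · rw [hw]
      ext α
      simpa [Matrix.mulVec, dotProduct, vandermonde, mul_comm] using (hu α.1 α.2).symm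
    · have := congrFun hKw i
      simp only [inner_sum, real_inner_smul_right, ha, ha₀, hinner]
      rw [Pi.add_apply] at this
      rw [← this]
      simp [Matrix.mulVec, dotProduct, gram, mul_comm]
  have hnorm : ‖a₀ - ∑ i, u i • a i‖ = √(sqError φ x u h) := by
    have hmem : ∀ b, h • augNodes x b ∈ Y := by
      rintro (_ | i)
      · simpa [augNodes] using h0
      · exact hxY i
    have hsum : a₀ - ∑ i, u i • a i =
        ∑ b, errCoeff u b • RKHS.kerFun H (⟨h • augNodes x b, hmem b⟩ : Y) (1 : ℝ) := by
      rw [Fintype.sum_option]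
      simp [errCoeff, augNodes, ha, ha₀, sub_eq_add_neg]
    rw [hsum, norm_eq_sqrt_real_inner]
    congr 1
    simp only [sum_inner, inner_sum, real_inner_smul_left, real_inner_smul_right, hinner, sqError]
    rw [Finset.sum_comm]
    refine Finset.sum_congr rfl fun b _ => Finset.sum_congr rfl fun b' _ => ?_
    rw [hkφ _ (hmem b) _ (hmem b')]
    ring
  -- The polynomial part of `f` cancels because `w` reproduces `P_A` at `0`.
  have herr : f 0 - posteriorMean k A (fun i => h • x i) f 0 =
      inner ℝ (a₀ - ∑ i, w i • a i) g := by
    have hres : ∑ i, w i * residual A f β (h • x i) =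
        ∑ i, w i * f (h • x i) - ∑ α ∈ A, β α * monomial α 0 := by
      simp only [residual, mul_sub, Finset.sum_sub_distrib, Finset.mul_sum]
      rw [Finset.sum_comm]
      congr 1
      refine Finset.sum_congr rfl fun α hα => ?_
      rw [← hw' α hα, Finset.mul_sum]
      exact Finset.sum_congr rfl fun i _ => by ring
    rw [inner_sub_left, sum_inner, hpost]
    simp only [real_inner_smul_left, ha, ha₀, RKHS.kerFun_inner, hg]
    have hone : ∀ t : ℝ, inner ℝ (1 : ℝ) t = t := fun t => by simp
    simp only [hone, hres]
    simp only [residual]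
    ring
  rw [herr, ← hnorm]
  exact (abs_real_inner_le_norm _ _).trans (mul_le_mul_of_nonneg_right hmin (norm_nonneg _))

theorem sqError_isBigO {φ : Pt d → ℝ} {x : Fin n → Pt d} {u : Fin n → ℝ} {m : ℕ}
    (hφ : ContDiffAt ℝ m φ 0)
    (hu : ∀ α, degree α < m → ∑ i, u i * monomial α (x i) = monomial α 0) :
    sqError φ x u =O[𝓝 0] fun h => h ^ m := by
  refine quadForm_isBigO hφ fun α hα => ?_
  rw [Fintype.sum_option]
  simp [errCoeff, augNodes, hu α hα]

/-- Translation invariance makes the diagonal of `k` constantly `φ 0`, which dominates all its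
values; the bound is therefore free of `h`. -/
theorem sqError_le {X : Set (Pt d)} {k : Pt d → Pt d → ℝ} (hk : IsPosDefKernel X k)
    {φ : Pt d → ℝ} (hkφ : ∀ y ∈ X, ∀ z ∈ X, k y z = φ (y - z)) (h0 : (0 : Pt d) ∈ X)
    {x : Fin n → Pt d} (u : Fin n → ℝ) {h : ℝ} (hxX : ∀ i, h • x i ∈ X) :
    sqError φ x u h ≤ ∑ a, ∑ b, |errCoeff u a * errCoeff u b| * φ 0 := by
  have hmem : ∀ b, h • augNodes x b ∈ X := by
    rintro (_ | i)
    · simpa [augNodes] using h0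
    · exact hxX i
  refine Finset.sum_le_sum fun a _ => Finset.sum_le_sum fun b _ => ?_
  refine (le_abs_self _).trans ?_
  rw [abs_mul]
  refine mul_le_mul_of_nonneg_left ?_ (abs_nonneg _)
  have := hk.abs_le (hmem a) (hmem b)
  rw [hkφ _ (hmem a) _ (hmem b), hkφ _ (hmem a) _ (hmem a), hkφ _ (hmem b) _ (hmem b)] at this
  simpa using this

end SPRE

theorem theorem4 {d n : ℕ} (X : Set (SPRE.Pt d)) (hX : 0 ∈ X)
    (A : Finset (Fin d → ℕ)) (hA : 0 ∈ A)
    (x : Fin n → SPRE.Pt d) (hx : Function.Injective x) (hxX : ∀ i, x i ∈ X)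
    (hU : SPRE.Unisolvent A x)
    (s : ℝ) (m : ℕ) (hm : (m : ℝ) = 2 * s)
    (hs : ∀ α : Fin d → ℕ, (SPRE.degree α : ℝ) < 2 * s → α ∈ A)
    (k : SPRE.Pt d → SPRE.Pt d → ℝ) (hk : SPRE.IsPosDefKernel X k)
    (φ : SPRE.Pt d → ℝ) (hkφ : ∀ y ∈ X, ∀ z ∈ X, k y z = φ (y - z))
    (hφ : ContDiffAt ℝ m φ 0) :
    ∃ C : ℝ → ℝ,
      (∀ h ∈ SPRE.permissible X, ∀ (f : SPRE.Pt d → ℝ) (β : (Fin d → ℕ) → ℝ),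
        (∃ c, SPRE.HasRKHSNorm X k (SPRE.residual A f β) c) →
        ∃ r, SPRE.HasRKHSNorm (SPRE.scaled X h) k (SPRE.residual A f β) r ∧
          |f 0 - SPRE.posteriorMean k A (fun i => h • x i) f 0| ≤ C h * r) ∧
      BddAbove (C '' SPRE.permissible X) ∧
      C =O[𝓝[SPRE.permissible X] 0] (fun h => h ^ s) := by
  have hV := hU.mulVec_injective
  -- The competitor is the SPRE rule at scale `1`; only its reproduction of `P_A` is kept.
  obtain ⟨u, -, hu, -⟩ := SPRE.exists_weights A (hk.gram_posDef hx hxX) hV 0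
  have hu' : ∀ α ∈ A, ∑ i, u i * SPRE.monomial α (x i) = SPRE.monomial α 0 := fun α hα => by
    have := congrFun hu ⟨α, hα⟩
    simpa [Matrix.mulVec, dotProduct, SPRE.vandermonde, mul_comm] using this
  have huh : ∀ h : ℝ, ∀ α ∈ A, ∑ i, u i * SPRE.monomial α (h • x i) = SPRE.monomial α 0 := by
    intro h α hα
    calc ∑ i, u i * SPRE.monomial α (h • x i)
        = h ^ SPRE.degree α * ∑ i, u i * SPRE.monomial α (x i) := by
          rw [Finset.mul_sum]
          exact Finset.sum_congr rfl fun i _ => by rw [SPRE.monomial_smul]; ring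
      _ = SPRE.monomial α 0 := by rw [hu' α hα, ← SPRE.monomial_smul, smul_zero]
  refine ⟨fun h => √(SPRE.sqError φ x u h), fun h hh f β ⟨c, hc⟩ => ?_, ?_, ?_⟩
  · obtain ⟨hpos, -, hmaps⟩ := hh
    have hsub : SPRE.scaled X h ⊆ X := Set.image_subset_iff.2 hmaps
    obtain ⟨r, hr⟩ := hc.restrict hsub
    refine ⟨r, hr, SPRE.abs_sub_posteriorMean_le
      (fun y hy z hz => hkφ y (hsub hy) z (hsub hz)) ⟨0, hX, smul_zero h⟩
      (fun i => ⟨x i, hxX i, rfl⟩) (hk.gram_posDef ?_ fun i => hmaps _ (hxX i))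
      (SPRE.mulVec_vandermonde_smul_injective hV hpos.ne') (huh h) hr⟩
    exact (smul_right_injective _ hpos.ne').comp hx
  · refine ⟨_, Set.forall_mem_image.2 fun h hh => Real.sqrt_le_sqrt
      (SPRE.sqError_le hk hkφ hX u fun i => hh.2.2 _ (hxX i))⟩
  · have hO := (SPRE.sqError_isBigO (u := u) (x := x) hφ fun α hα => hu' α (hs α (by
      rw [← hm]; exact_mod_cast hα))).mono (nhdsWithin_le_nhds (s := SPRE.permissible X))
    obtain ⟨D, hD⟩ := hO.bound
    refine Asymptotics.IsBigO.of_bound (√D) ?_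
    filter_upwards [hD, self_mem_nhdsWithin] with h hle hh
    have hpos : 0 < h := hh.1
    -- The rate is halved because `sqError` is a squared norm and `m = 2s`.
    have hpow : √(h ^ m) = h ^ s := by
      rw [Real.sqrt_eq_rpow, ← Real.rpow_natCast, ← Real.rpow_mul hpos.le, hm]
      congr 1
      ring
    rw [Real.norm_of_nonneg (Real.sqrt_nonneg _), Real.norm_of_nonneg (Real.rpow_nonneg hpos.le _),
      ← hpow, ← Real.sqrt_mul' _ (by positivity)]
    refine Real.sqrt_le_sqrt ((le_abs_self _).trans ?_)
    simpa [Real.norm_of_nonneg hpos.le, abs_of_pos hpos] using hle
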